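/- Let $\mathbb D=\{z\in\mathbb C:|z|<1\}$ and let $v(z)=1$ for $|z|\le 1-1/e$ and $v(z)=(-\log(1-|z|))^{-1}$ for $1-1/e\le|z|<1$. For $k\in\mathbb N=\{1,2,\dots\}$ let $H^\infty_{v^k}$ be the Banach space of all analytic functions $f$ on $\mathbb D$ with $\|f\|_k:=\sup_{z\in\mathbb D}v(z)^k|f(z)|<\infty$. Let $VH(\mathbb D)=\bigcup_{k\in\mathbb N}H^\infty_{v^k}$, endowed with the finest locally convex topology for which all the inclusions $H^\infty_{v^k}\subset VH(\mathbb D)$ are continuous. For $t\in[0,1)$ and $f$ analytic on $\mathbb D$ put $$C_tf(0)=f(0),\qquad C_tf(z)=\frac1z\int_0^z\frac{f(\zeta)}{1-t\zeta}\,d\zeta\quad(z\in\mathbb D\setminus\{0\}).$$ Then, for every $t\in[0,1)$, $C_t$ is a continuous linear operator from $VH(\mathbb D)$ into itself with the following properties. 1. $C_t$ is power bounded: the set of iterates $\{C_t^n:n\ge 0\}$ is equicontinuous on $VH(\mathbb D)$. 2. $C_t$ is uniformly mean ergodic: the sequence of averages $\frac1n\sum_{m=1}^nC_t^m$, $n\in\mathbb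 N$, converges in the space of continuous linear operators on $VH(\mathbb D)$ with respect to the topology of uniform convergence on the bounded subsets of $VH(\mathbb D)$. 3. $C_t$ is not supercyclic: there is no $f\in VH(\mathbb D)$ whose projective orbit $\{\lambda C_t^nf:\lambda\in\mathbb C,\ n\ge 0\}$ is dense in $VH(\mathbb D)$. -/

import Mathlib

open Filter Topology Metric

/-! ### Operators on topological vector spaces -/

section Dynamics

variable {E : Type*} [AddCommGroup E] [Module ℂ E] [TopologicalSpace E]

/-- `T` is power bounded: the iterates `T ^ n`, `n ≥ 0`, form an equicontinuous family, for the
uniform structure of the additive topological group `E`. -/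
def IsPowerBounded [IsTopologicalAddGroup E] (T : E →L[ℂ] E) : Prop :=
  letI : UniformSpace E := IsTopologicalAddGroup.rightUniformSpace E
  Equicontinuous (fun (n : ℕ) (x : E) => (T ^ n) x)

/-- The averages `(1 / n) ∑_{m=1}^n T ^ m` (used for `n ≥ 1`). -/
noncomputable def ergodicMean [IsTopologicalAddGroup E] [ContinuousConstSMul ℂ E]
    (T : E →L[ℂ] E) (n : ℕ) : E →L[ℂ] E :=
  (n : ℂ)⁻¹ • ∑ m ∈ Finset.Icc 1 n, T ^ m

/-- `T` is uniformly mean ergodic: its averages converge in the space of continuous operators,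
which Mathlib endows with the topology of uniform convergence on bounded sets. -/
def IsUniformlyMeanErgodic [IsTopologicalAddGroup E] [ContinuousConstSMul ℂ E]
    (T : E →L[ℂ] E) : Prop :=
  ∃ P : E →L[ℂ] E, Tendsto (ergodicMean T) atTop (𝓝 P)

/-- `T` is supercyclic: some projective orbit `{c • T ^ n x | c ∈ ℂ, n ≥ 0}` is dense. -/
def IsSupercyclic (T : E →L[ℂ] E) : Prop :=
  ∃ x : E, Dense {y : E | ∃ (c : ℂ) (n : ℕ), y = c • (T ^ n) x}

end Dynamics

/-- The finest locally convex topology on `E` making all the maps `j i : X i → E` continuous.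
In Mathlib's order on topologies, `t ≤ t'` means that `t` is finer than `t'`. -/
abbrev lcInductiveTopology {ι : Type*} {X : ι → Type*} [∀ i, TopologicalSpace (X i)]
    {E : Type*} [AddCommGroup E] [Module ℂ E] (j : ∀ i, X i → E) : TopologicalSpace E :=
  sInf {t : TopologicalSpace E |
    (∀ i, Continuous[inferInstance, t] (j i)) ∧
    @IsTopologicalAddGroup E t _ ∧
    @ContinuousSMul ℂ E _ _ t ∧
    @LocallyConvexSpace ℝ E _ _ _ _ t}

/-! ### The space `VH(𝔻)` -/

/-- The holomorphic functions on the open unit disc. Such a function is represented by its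
extension by zero to `ℂ`, so that two elements are equal iff they agree on the disc. -/
def discHol : Submodule ℂ (ℂ → ℂ) where
  carrier := {f | DifferentiableOn ℂ f (ball 0 1) ∧ ∀ z ∉ ball (0 : ℂ) 1, f z = 0}
  zero_mem' := ⟨differentiableOn_const 0, fun _ _ => rfl⟩
  add_mem' := fun hf hg =>
    ⟨hf.1.add hg.1, fun z hz => by simp [hf.2 z hz, hg.2 z hz]⟩
  smul_mem' := fun c _ hf => ⟨hf.1.const_smul c, fun z hz => by simp [hf.2 z hz]⟩

/-- The logarithmic weight, as a function of the radius `r ∈ [0, 1)`. -/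
noncomputable def logWeight (r : ℝ) : ℝ :=
  if r ≤ 1 - 1 / Real.exp 1 then 1 else (-Real.log (1 - r))⁻¹

theorem logWeight_pos {r : ℝ} (hr : r < 1) : 0 < logWeight r := by
  unfold logWeight
  split_ifs with h
  · exact one_pos
  · have he : 1 / Real.exp 1 < 1 := by
      rw [div_lt_one (Real.exp_pos 1)]
      exact Real.one_lt_exp_iff.mpr one_pos
    have : Real.log (1 - r) < 0 := Real.log_neg (by linarith) (by linarith)
    exact inv_pos.mpr (by linarith)

/-- The holomorphic functions `f` on the disc with `sup_{|z| < 1} v(z) ^ k |f(z)| < ∞`, for the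
logarithmic weight `v`. -/
def logGrowth (k : ℕ) : Submodule ℂ (ℂ → ℂ) where
  carrier := {f | f ∈ discHol ∧
    BddAbove (Set.range fun z : ball (0 : ℂ) 1 => logWeight ‖(z : ℂ)‖ ^ k * ‖f z‖)}
  zero_mem' := ⟨discHol.zero_mem, 0, by rintro _ ⟨z, rfl⟩; simp⟩
  add_mem' := by
    rintro f g ⟨hf, A, hA⟩ ⟨hg, B, hB⟩
    refine ⟨discHol.add_mem hf hg, A + B, ?_⟩
    rintro _ ⟨z, rfl⟩
    have h0 := (pow_pos (logWeight_pos (mem_ball_zero_iff.mp z.2)) k).le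
    have h1 := hA ⟨z, rfl⟩
    have h2 := hB ⟨z, rfl⟩
    have h3 := mul_le_mul_of_nonneg_left (norm_add_le (f z) (g z)) h0
    simp only [Pi.add_apply] at *
    linarith
  smul_mem' := by
    rintro c f ⟨hf, A, hA⟩
    refine ⟨discHol.smul_mem c hf, ‖c‖ * A, ?_⟩
    rintro _ ⟨z, rfl⟩
    have h1 := mul_le_mul_of_nonneg_left (hA ⟨z, rfl⟩) (norm_nonneg c)
    simp only [Pi.smul_apply, smul_eq_mul, norm_mul] at *
    linarith

/-- The weighted Banach space `H^∞_{v^k}` for the logarithmic weight `v`. It is a type of its own,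
so that it carries the weighted sup norm and not the topology of `ℂ → ℂ`. -/
def LogGrowth (k : ℕ) : Type := logGrowth k

namespace LogGrowth

variable {k : ℕ}

instance : AddCommGroup (LogGrowth k) := inferInstanceAs (AddCommGroup (logGrowth k))

noncomputable instance : Module ℂ (LogGrowth k) := inferInstanceAs (Module ℂ (logGrowth k))

/-- The weighted supremum norm `‖f‖ = sup_{|z| < 1} v(z) ^ k |f(z)|`. -/
noncomputable instance : Norm (LogGrowth k) where
  norm f := ⨆ z : ball (0 : ℂ) 1, logWeight ‖(z : ℂ)‖ ^ k * ‖f.1 z‖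

theorem le_norm (f : LogGrowth k) (z : ball (0 : ℂ) 1) :
    logWeight ‖(z : ℂ)‖ ^ k * ‖f.1 z‖ ≤ ‖f‖ :=
  le_ciSup f.2.2 z

theorem weight_pos (k : ℕ) (z : ball (0 : ℂ) 1) : 0 < logWeight ‖(z : ℂ)‖ ^ k :=
  pow_pos (logWeight_pos (mem_ball_zero_iff.mp z.2)) k

theorem core : NormedSpace.Core ℂ (LogGrowth k) where
  norm_nonneg f := Real.iSup_nonneg fun z => mul_nonneg (weight_pos k z).le (norm_nonneg _)
  norm_smul c f := by
    change (⨆ z : ball (0 : ℂ) 1, logWeight ‖(z : ℂ)‖ ^ k * ‖c • f.1 z‖) = ‖c‖ * ⨆ z, _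
    rw [Real.mul_iSup_of_nonneg (norm_nonneg c)]
    congr 1
    funext z
    rw [norm_smul]
    ring
  norm_triangle f g := by
    have : Nonempty (ball (0 : ℂ) 1) := ⟨⟨0, by simp⟩⟩
    refine ciSup_le fun z => ?_
    have h1 := mul_le_mul_of_nonneg_left (norm_add_le (f.1 z) (g.1 z)) (weight_pos k z).le
    have h2 := le_norm f z
    have h3 := le_norm g z
    change logWeight ‖(z : ℂ)‖ ^ k * ‖f.1 z + g.1 z‖ ≤ _
    linarith
  norm_eq_zero_iff f := by
    refine ⟨fun h => Subtype.ext (funext fun z => ?_), ?_⟩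
    · by_cases hz : z ∈ ball (0 : ℂ) 1
      · have h1 := le_norm f ⟨z, hz⟩
        rw [h] at h1
        have h2 := nonpos_of_mul_nonpos_right h1 (weight_pos k ⟨z, hz⟩)
        exact norm_le_zero_iff.mp h2
      · exact f.2.1.2 z hz
    · rintro rfl
      change (⨆ z : ball (0 : ℂ) 1, logWeight ‖(z : ℂ)‖ ^ k * ‖(0 : ℂ)‖) = 0
      simp

noncomputable instance : NormedAddCommGroup (LogGrowth k) := NormedAddCommGroup.ofCore core

noncomputable instance : NormedSpace ℂ (LogGrowth k) := NormedSpace.ofCore core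

end LogGrowth

theorem logWeight_le_one {r : ℝ} (hr : r < 1) : logWeight r ≤ 1 := by
  unfold logWeight
  split_ifs with h
  · exact le_rfl
  · refine inv_le_one_of_one_le₀ ?_
    have h1 : 1 - r ≤ Real.exp (-1) := by
      rw [Real.exp_neg, ← one_div]
      linarith
    have h2 := Real.log_le_log (by linarith) h1
    rw [Real.log_exp] at h2
    linarith

theorem logGrowth_mono {k l : ℕ} (h : k ≤ l) : logGrowth k ≤ logGrowth l := by
  rintro f ⟨hf, A, hA⟩
  refine ⟨hf, A, ?_⟩
  rintro _ ⟨z, rfl⟩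
  have hz : ‖(z : ℂ)‖ < 1 := mem_ball_zero_iff.mp z.2
  exact (mul_le_mul_of_nonneg_right
    (pow_le_pow_of_le_one (logWeight_pos hz).le (logWeight_le_one hz) h)
    (norm_nonneg _)).trans (hA ⟨z, rfl⟩)

/-- The functions of logarithmic growth: the union of the spaces `H^∞_{v^k}`, `k ≥ 1`, where
`k = n + 1` with `n : ℕ`. -/
def vh : Submodule ℂ (ℂ → ℂ) where
  carrier := {f | ∃ n : ℕ, f ∈ logGrowth (n + 1)}
  zero_mem' := ⟨0, Submodule.zero_mem _⟩
  add_mem' := by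
    rintro f g ⟨m, hf⟩ ⟨n, hg⟩
    exact ⟨max m n, Submodule.add_mem _ (logGrowth_mono (by simp) hf)
      (logGrowth_mono (by simp) hg)⟩
  smul_mem' := by
    rintro c f ⟨n, hf⟩
    exact ⟨n, Submodule.smul_mem _ c hf⟩

/-- The space `VH(𝔻)`. It is a type of its own, so that it carries the inductive limit topology
and not the topology of `ℂ → ℂ`. -/
def VH : Type := vh

namespace VH

instance : AddCommGroup VH := inferInstanceAs (AddCommGroup vh)

noncomputable instance : Module ℂ VH := inferInstanceAs (Module ℂ vh)

/-- An element of `VH(𝔻)` as a function; only the values on the open unit disc matter. -/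
instance : CoeFun VH fun _ => ℂ → ℂ := ⟨Subtype.val⟩

/-- The inclusion of `H^∞_{v^(n+1)}` into `VH(𝔻)`. -/
def incl (n : ℕ) (f : LogGrowth (n + 1)) : VH := ⟨f.1, n, f.2⟩

/-- The inductive limit topology of `VH(𝔻) = ind_k H^∞_{v^k}`. -/
noncomputable instance : TopologicalSpace VH := lcInductiveTopology incl

instance : IsTopologicalAddGroup VH := topologicalAddGroup_sInf fun _ h => h.2.1

instance : ContinuousSMul ℂ VH := continuousSMul_sInf fun _ h => h.2.2.1

instance : LocallyConvexSpace ℝ VH := LocallyConvexSpace.sInf fun _ h => h.2.2.2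

end VH

/-! ### The generalized Cesàro operator -/

/-- `C_t f (z) = (1 / z) ∫_0^z f(ζ) / (1 - t ζ) dζ` for `z ≠ 0`, and `C_t f (0) = f(0)`; the path
integral is taken along the segment `ζ = s z`, `0 ≤ s ≤ 1`. -/
noncomputable def genCesaro (t : ℝ) (f : ℂ → ℂ) (z : ℂ) : ℂ :=
  if z = 0 then f 0
  else z⁻¹ * ∫ s in (0 : ℝ)..1, f (s * z) / (1 - t * (s * z)) * z

/-!
With `ψ(z) = z / (1 - t z)`, the substitution `g(z) = (1 - t z) f(z)` turns `C_t` into the averaging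
operator `g ↦ (1 / ψ(z)) ∫ g dψ`. The image `ψ(𝔻)`, like the image of every smaller disc about `0`,
is a disc containing `0`, so that the integral can be taken along the segment from `0` to `ψ(z)`.
On functions vanishing at `0` this averaging gains a factor `1 / 2`. `norm_genCesaro_le` expresses
this as a pointwise estimate on discs `|w| ≤ r`; as the weight is radial and decreasing, the estimate
combines with the Schwarz lemma (`norm_le_of_growth`) to give `‖C_t ^ n f‖_k ≤ K 2 ^ (-n) ‖f‖_k`
whenever `f(0) = 0`, where `K` depends on `t` only. Since `1 / (1 - t z)` is fixed by `C_t`, it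
follows that on each step `C_t ^ n` tends geometrically in norm to the projection
`P f = f(0) / (1 - t z)` (`VH.exists_growthBound_cesaro_pow_sub`).

The passage from the steps to the inductive limit rests on one principle: a seminorm on `VH(𝔻)` is
continuous as soon as it is bounded on the unit ball of each step
(`VH.continuous_seminorm_iff`). For a family of operators `T i` uniformly bounded on each step and a
continuous seminorm `p`, it applies to `sup_i p ∘ T i` (`VH.exists_seminorm_dominating`). For the
family `C_t ^ n` this is power boundedness. For the family `n (A_n - P)`, where `A_n` is the `n`-th
ergodic mean, it gives `p ((A_n - P) f) ≤ q f / n` with a continuous seminorm `q`, hence convergence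
uniformly on bounded sets; the bounded sets of `VH(𝔻)` need not be described in terms of the steps.

Supercyclicity fails because `C_t ^ n f (0) = f(0)` while `C_t ^ n f` is bounded at `1 / 2`: each
projective orbit lies in a proper closed set defined by the values at these two points.
-/

/-! ### Locally convex spaces -/

/-- A complex topological vector space that is locally convex over `ℝ` is generated by its
continuous complex seminorms. -/
theorem polynormableSpace_complex_of_real {E : Type*} [AddCommGroup E] [Module ℂ E]
    [TopologicalSpace E] [IsTopologicalAddGroup E] [ContinuousSMul ℂ E] [LocallyConvexSpace ℝ E] :
    PolynormableSpace ℂ E := by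
  open scoped ComplexOrder in
  have : LocallyConvexSpace ℂ E := ⟨fun x =>
    (LocallyConvexSpace.convex_basis (𝕜 := ℝ) x).to_hasBasis
      (fun s hs => ⟨s, ⟨hs.1, convex_of_nonneg_surjective_algebraMap _
        (fun _ h => RCLike.nonneg_iff_exists_ofReal.mp h) hs.2⟩, subset_rfl⟩)
      (fun s hs => ⟨s, ⟨hs.1, hs.2.lift ℝ⟩, subset_rfl⟩)⟩
  have : ContinuousSMul ℝ E := IsScalarTower.continuousSMul ℂ
  exact LocallyConvexSpace.toPolynormableSpace

/-- If the operators `n • S n` are dominated, seminorm by seminorm, by continuous seminorms not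
depending on `n`, then `S n` tends to zero uniformly on bounded sets: `p (S n x) ≤ q x / n`, and `q`
is bounded on bounded sets. -/
theorem tendsto_zero_of_seminorm_bound {E : Type*} [AddCommGroup E] [Module ℂ E]
    [TopologicalSpace E] [IsTopologicalAddGroup E] [ContinuousSMul ℂ E] [PolynormableSpace ℂ E]
    (S : ℕ → E →L[ℂ] E)
    (hS : ∀ p : Seminorm ℂ E, Continuous p → ∃ q : Seminorm ℂ E, Continuous q ∧
      ∀ n x, p (n • S n x) ≤ q x) :
    Tendsto S atTop (𝓝 0) := by
  have hE := PolynormableSpace.withSeminorms ℂ E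
  rw [(ContinuousLinearMap.hasBasis_nhds_zero).tendsto_right_iff]
  rintro ⟨B, U⟩ ⟨hB, hU⟩
  obtain ⟨V, hV, hVU⟩ := hE.hasBasis.mem_iff.mp hU
  obtain ⟨s, r, hr, rfl⟩ := SeminormFamily.basisSets_iff _ |>.mp hV
  choose q hqc hq using fun p : {p : Seminorm ℂ E // Continuous p} => hS p.1 p.2
  have key : ∀ p ∈ s, ∀ᶠ n : ℕ in atTop, ∀ x ∈ B, p.1 (S n x) < r := by
    intro p _
    obtain ⟨R, hR, hBR⟩ := hE.isVonNBounded_iff_seminorm_bounded.mp hB ⟨q p, hqc p⟩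
    obtain ⟨N, hN⟩ := exists_nat_gt (R / r)
    filter_upwards [eventually_ge_atTop N, eventually_gt_atTop 0] with n hn hn0 x hx
    have h1 := (hq p n x).trans_lt (hBR x hx)
    rw [← Nat.cast_smul_eq_nsmul ℂ, map_smul_eq_mul] at h1
    simp only [Complex.norm_natCast] at h1
    rw [div_lt_iff₀ hr] at hN
    have h2 : (N : ℝ) ≤ n := by exact_mod_cast hn
    have h3 : (0 : ℝ) < n := by exact_mod_cast hn0
    nlinarith [apply_nonneg p.1 (S n x)]
  filter_upwards [(Finset.eventually_all s).mpr key] with n hn x hx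
  refine hVU ?_
  rw [id, Seminorm.mem_ball_zero]
  exact Seminorm.finset_sup_apply_lt hr fun p hp => hn p hp x hx

/-! ### Continuity on the inductive limit -/

namespace VH

/-- `f.GrowthBound k A` says that the norm of `f` in `H^∞_{v^k}` is at most `A`; unlike the norm,
it makes sense for every element of `VH(𝔻)`. -/
def GrowthBound (k : ℕ) (A : ℝ) (f : VH) : Prop :=
  ∀ z ∈ ball (0 : ℂ) 1, logWeight ‖z‖ ^ k * ‖f z‖ ≤ A

theorem growthBound_incl (n : ℕ) (f : LogGrowth (n + 1)) : GrowthBound (n + 1) ‖f‖ (incl n f) :=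
  fun z hz => LogGrowth.le_norm f ⟨z, hz⟩

/-- The inclusion of a step, as a linear map. -/
def inclₗ (n : ℕ) : LogGrowth (n + 1) →ₗ[ℂ] VH where
  toFun := incl n
  map_add' _ _ := rfl
  map_smul' _ _ := rfl

theorem continuous_incl (n : ℕ) : Continuous (incl n) :=
  continuous_sInf_rng.mpr fun _ h => h.1 n

theorem GrowthBound.exists_incl {n : ℕ} {A : ℝ} {f : VH} (hf : GrowthBound (n + 1) A f) :
    ∃ g : LogGrowth (n + 1), incl n g = f ∧ ‖g‖ ≤ A := by
  have : Nonempty (ball (0 : ℂ) 1) := ⟨⟨0, by simp⟩⟩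
  obtain ⟨_, hm, _⟩ := f.2
  exact ⟨⟨f.1, hm, A, by rintro _ ⟨z, rfl⟩; exact hf z z.2⟩, rfl, ciSup_le fun z => hf z z.2⟩

/-- A seminorm on `VH(𝔻)` is continuous iff it is bounded on the unit ball of each step. -/
theorem continuous_seminorm_iff (p : Seminorm ℂ VH) :
    Continuous p ↔ ∀ n, ∃ c, 0 ≤ c ∧ ∀ A f, GrowthBound (n + 1) A f → p f ≤ c * A := by
  constructor
  · intro hp n
    obtain ⟨c, hc, h⟩ := Seminorm.bound_of_continuous_normedSpace (p.comp (inclₗ n))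
      (hp.comp (continuous_incl n))
    refine ⟨c, hc.le, fun A f hf => ?_⟩
    obtain ⟨g, rfl, hg⟩ := hf.exists_incl
    exact (h g).trans (mul_le_mul_of_nonneg_left hg hc.le)
  · intro h
    let G : SeminormedAddCommGroup VH := p.toAddGroupSeminorm.toSeminormedAddCommGroup
    let _ : NormedSpace ℂ VH := { norm_smul_le := fun a b => (map_smul_eq_mul p a b).le }
    let t : TopologicalSpace VH := G.toUniformSpace.toTopologicalSpace
    have hle : lcInductiveTopology incl ≤ t := by
      refine sInf_le ⟨fun n => ?_, ?_, ?_, ?_⟩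
      · obtain ⟨c, -, hc⟩ := h n
        exact AddMonoidHomClass.continuous_of_bound (inclₗ n) c
          fun f => hc _ _ (growthBound_incl n f)
      · exact (inferInstance : @IsTopologicalAddGroup VH t _)
      · exact (inferInstance : @ContinuousSMul ℂ VH _ _ t)
      · exact (inferInstance : @LocallyConvexSpace ℝ VH _ _ _ _ t)
    have h2 : Continuous[t, _] p := continuous_norm (E := VH)
    exact continuous_le_dom hle h2

instance : PolynormableSpace ℂ VH := polynormableSpace_complex_of_real

/-- Families of linear maps that are uniformly bounded on each step are dominated, seminorm by
seminorm, by continuous seminorms: the supremum of `p ∘ T i` is finite and bounded on each step. -/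
theorem exists_seminorm_dominating {ι : Type*} (T : ι → VH →ₗ[ℂ] VH)
    (hT : ∀ k, ∃ M, 0 ≤ M ∧ ∀ i A f, GrowthBound (k + 1) A f → GrowthBound (k + 1) (M * A) (T i f))
    (p : Seminorm ℂ VH) (hp : Continuous p) :
    ∃ q : Seminorm ℂ VH, Continuous q ∧ ∀ i, p.comp (T i) ≤ q := by
  have hstep : ∀ n, ∃ c, 0 ≤ c ∧ ∀ i A f, GrowthBound (n + 1) A f → p.comp (T i) f ≤ c * A := by
    intro n
    obtain ⟨c, hc0, hc⟩ := (continuous_seminorm_iff p).mp hp n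
    obtain ⟨M, hM0, hM⟩ := hT n
    refine ⟨c * M, mul_nonneg hc0 hM0, fun i A f hf => ?_⟩
    rw [mul_assoc]
    exact hc _ _ (hM i A f hf)
  have hbdd : BddAbove (Set.range fun i => p.comp (T i)) := by
    rw [Seminorm.bddAbove_range_iff]
    rintro f
    obtain ⟨n, hn⟩ := f.2
    obtain ⟨c, -, hc⟩ := hstep n
    let g : LogGrowth (n + 1) := ⟨f.1, hn⟩
    refine ⟨c * ‖g‖, ?_⟩
    rintro _ ⟨i, rfl⟩
    exact hc i _ f (growthBound_incl n g)
  refine ⟨⨆ i, p.comp (T i), ?_, fun i => le_ciSup hbdd i⟩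
  rw [continuous_seminorm_iff]
  intro n
  obtain ⟨c, hc0, hc⟩ := hstep n
  refine ⟨c, hc0, fun A f hf => ?_⟩
  rw [Seminorm.iSup_apply hbdd]
  have hA : 0 ≤ A := (mul_nonneg (pow_nonneg (logWeight_pos (by simp)).le _)
    (norm_nonneg _)).trans (hf 0 (by simp))
  exact Real.iSup_le (fun i => hc i A f hf) (mul_nonneg hc0 hA)

theorem equicontinuous_of_growthBound {ι : Type*} (T : ι → VH →ₗ[ℂ] VH)
    (hT : ∀ k, ∃ M, 0 ≤ M ∧
      ∀ i A f, GrowthBound (k + 1) A f → GrowthBound (k + 1) (M * A) (T i f)) :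
    letI : UniformSpace VH := IsTopologicalAddGroup.rightUniformSpace VH
    Equicontinuous fun i x => T i x := by
  let _ : UniformSpace VH := IsTopologicalAddGroup.rightUniformSpace VH
  have : IsUniformAddGroup VH := isUniformAddGroup_of_addCommGroup
  exact ((PolynormableSpace.withSeminorms ℂ
    VH).uniformEquicontinuous_iff_exists_continuous_seminorm T).mpr
    (fun p => exists_seminorm_dominating T hT p.1 p.2) |>.equicontinuous

theorem continuous_of_growthBound (T : VH →ₗ[ℂ] VH)
    (hT : ∀ k, ∃ M, 0 ≤ M ∧ ∀ A f, GrowthBound (k + 1) A f → GrowthBound (k + 1) (M * A) (T f)) :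
    Continuous T :=
  let _ : UniformSpace VH := IsTopologicalAddGroup.rightUniformSpace VH
  (equicontinuous_of_growthBound (fun _ : Unit => T) fun k =>
    (hT k).imp fun _ h => ⟨h.1, fun _ => h.2⟩).continuous ()

theorem continuous_eval {z : ℂ} (hz : z ∈ ball (0 : ℂ) 1) : Continuous fun f : VH => f z := by
  let e : VH →ₗ[ℂ] ℂ := ⟨⟨fun f => f z, fun _ _ => rfl⟩, fun _ _ => rfl⟩
  have hw : 0 < logWeight ‖z‖ := logWeight_pos (mem_ball_zero_iff.mp hz)
  have hp : Continuous ((normSeminorm ℂ ℂ).comp e) := by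
    rw [continuous_seminorm_iff]
    refine fun n => ⟨(logWeight ‖z‖ ^ (n + 1))⁻¹, by positivity, fun A f hf => ?_⟩
    rw [← div_eq_inv_mul, le_div_iff₀' (by positivity)]
    exact hf z hz
  refine continuous_of_continuousAt_zero e ?_
  have h0 := hp.tendsto 0
  rw [map_zero] at h0
  rw [ContinuousAt, map_zero]
  exact tendsto_zero_iff_norm_tendsto_zero.mpr h0

end VH

/-! ### The logarithmic weight -/

theorem logWeight_antitoneOn : AntitoneOn logWeight (Set.Iio 1) := by
  intro r hr s hs hrs
  by_cases h : r ≤ 1 - 1 / Real.exp 1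
  · exact (logWeight_le_one hs).trans_eq (if_pos h).symm
  · have hs' : ¬ s ≤ 1 - 1 / Real.exp 1 := fun h' => h (hrs.trans h')
    have he : 1 / Real.exp 1 < 1 := by
      rw [div_lt_one (Real.exp_pos 1)]
      exact Real.one_lt_exp_iff.mpr one_pos
    rw [logWeight, logWeight, if_neg h, if_neg hs']
    have h1 : Real.log (1 - r) < 0 :=
      Real.log_neg (by linarith [Set.mem_Iio.mp hr]) (by linarith)
    have h2 := Real.log_le_log (by linarith [Set.mem_Iio.mp hs]) (by linarith : 1 - s ≤ 1 - r)
    exact inv_anti₀ (by linarith) (by linarith)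

theorem logWeight_of_le_half {r : ℝ} (hr : r ≤ 1 / 2) : logWeight r = 1 := by
  have h : (2 : ℝ) ≤ Real.exp 1 := by linarith [Real.add_one_le_exp 1]
  refine if_pos (hr.trans ?_)
  have := one_div_le_one_div_of_le two_pos h
  linarith

/-- A form of the Schwarz lemma: up to the factor 2, the weighted bound of a function vanishing at
`0` survives division by `z`. -/
theorem norm_le_of_growth {f : ℂ → ℂ} {k : ℕ} {A : ℝ} (hd : DifferentiableOn ℂ f (ball 0 1))
    (hf : ∀ z ∈ ball (0 : ℂ) 1, logWeight ‖z‖ ^ k * ‖f z‖ ≤ A) (h0 : f 0 = 0) {r : ℝ} (hr : r < 1)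
    {z : ℂ} (hz : ‖z‖ ≤ r) : ‖f z‖ ≤ 2 * A / logWeight r ^ k * ‖z‖ := by
  have hA : 0 ≤ A := (mul_nonneg (pow_nonneg (logWeight_pos (by simp)).le _)
    (norm_nonneg _)).trans (hf 0 (by simp))
  have hw := pow_pos (logWeight_pos hr) k
  have hz1 : ‖z‖ < 1 := hz.trans_lt hr
  rcases lt_or_ge ‖z‖ (1 / 2) with h | h
  · have h1 := Complex.dist_le_div_mul_dist_of_mapsTo_ball (R₂ := A) (z := z)
      (hd.mono (ball_subset_ball (by norm_num : (1 / 2 : ℝ) ≤ 1))) (fun w hw' => by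
        rw [mem_ball_zero_iff] at hw'
        have := hf w (by simp; linarith)
        rw [logWeight_of_le_half hw'.le, one_pow, one_mul] at this
        simpa [h0] using this) (by simpa using h)
    rw [h0, dist_zero_right, dist_zero_right] at h1
    refine h1.trans (mul_le_mul_of_nonneg_right ?_ (norm_nonneg _))
    rw [le_div_iff₀ hw]
    have := pow_le_one₀ (logWeight_pos hr).le (logWeight_le_one hr) (n := k)
    nlinarith
  · have h1 := hf z (by simpa using hz1)
    have h2 := pow_le_pow_left₀ (logWeight_pos hr).le (logWeight_antitoneOn hz1 hr hz) k
    rw [div_mul_eq_mul_div, le_div_iff₀ hw]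
    nlinarith [mul_le_mul_of_nonneg_right h2 (norm_nonneg (f z))]

/-! ### The Cesàro integral -/

section Cesaro

variable {t : ℝ}

theorem one_sub_le_norm_one_sub (ht : t ∈ Set.Ico (0 : ℝ) 1) {z : ℂ} (hz : ‖z‖ < 1) :
    1 - t ≤ ‖1 - t * z‖ := by
  have h := norm_sub_norm_le (1 : ℂ) (t * z)
  rw [norm_one, norm_mul, Complex.norm_real, Real.norm_of_nonneg ht.1] at h
  nlinarith [ht.1, norm_nonneg z]

theorem one_sub_ne_zero (ht : t ∈ Set.Ico (0 : ℝ) 1) {z : ℂ} (hz : ‖z‖ < 1) : 1 - t * z ≠ 0 :=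
  norm_pos_iff.mp ((sub_pos.mpr ht.2).trans_le (one_sub_le_norm_one_sub ht hz))

theorem exists_primitive (ht : t ∈ Set.Ico (0 : ℝ) 1) {f : ℂ → ℂ}
    (hf : DifferentiableOn ℂ f (ball 0 1)) :
    ∃ F : ℂ → ℂ, F 0 = 0 ∧ ∀ z ∈ ball (0 : ℂ) 1, HasDerivAt F (f z / (1 - t * z)) z :=
  (DifferentiableOn.isExactOn_ball (f := fun z => f z / (1 - t * z)) (hf.div (by fun_prop)
    fun _ hz => one_sub_ne_zero ht (mem_ball_zero_iff.mp hz))).with_val_at 0 0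

theorem mul_genCesaro_eq (ht : t ∈ Set.Ico (0 : ℝ) 1) {f F : ℂ → ℂ}
    (hf : ContinuousOn f (ball 0 1)) (hF0 : F 0 = 0)
    (hF : ∀ z ∈ ball (0 : ℂ) 1, HasDerivAt F (f z / (1 - t * z)) z) {z : ℂ}
    (hz : z ∈ ball (0 : ℂ) 1) : z * genCesaro t f z = F z := by
  rcases eq_or_ne z 0 with rfl | hz0
  · simp [hF0]
  have hmem : ∀ s ∈ Set.uIcc (0 : ℝ) 1, (s : ℂ) * z ∈ ball (0 : ℂ) 1 := by
    intro s hs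
    rw [Set.uIcc_of_le zero_le_one] at hs
    rw [mem_ball_zero_iff] at hz ⊢
    rw [norm_mul, Complex.norm_real, Real.norm_of_nonneg hs.1]
    nlinarith [hs.2, norm_nonneg z]
  have hc : Continuous fun s : ℝ => (s : ℂ) * z := by fun_prop
  have h := intervalIntegral.integral_eq_sub_of_hasDerivAt (a := 0) (b := 1)
    (f := fun s : ℝ => F (s * z)) (f' := fun s : ℝ => f (s * z) / (1 - t * (s * z)) * z)
    (fun s hs => by
      have h1 : HasDerivAt (fun s : ℝ => (s : ℂ) * z) z s := by
        simpa using (Complex.ofRealCLM.hasDerivAt (x := s)).mul_const z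
      exact (hF _ (hmem s hs)).comp s h1)
    (ContinuousOn.intervalIntegrable <| ((hf.comp hc.continuousOn hmem).div (by fun_prop)
      fun s hs => one_sub_ne_zero ht (mem_ball_zero_iff.mp (hmem s hs))).mul continuousOn_const)
  rw [genCesaro, if_neg hz0, h]
  simp [hF0, hz0]

theorem genCesaro_zero (f : ℂ → ℂ) : genCesaro t f 0 = f 0 := if_pos rfl

theorem differentiableOn_genCesaro (ht : t ∈ Set.Ico (0 : ℝ) 1) {f : ℂ → ℂ}
    (hf : DifferentiableOn ℂ f (ball 0 1)) : DifferentiableOn ℂ (genCesaro t f) (ball 0 1) := by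
  obtain ⟨F, hF0, hF⟩ := exists_primitive ht hf
  have h0 : (0 : ℂ) ∈ ball (0 : ℂ) 1 := by simp
  refine ((Complex.differentiableOn_dslope (isOpen_ball.mem_nhds h0)).mpr
    fun z hz => (hF z hz).differentiableAt.differentiableWithinAt).congr fun z hz => ?_
  rcases eq_or_ne z 0 with rfl | hz0
  · simp [genCesaro_zero, (hF 0 h0).deriv]
  · rw [dslope_of_ne _ hz0, slope_def_field, ← mul_genCesaro_eq ht hf.continuousOn hF0 hF hz, hF0]
    simp [hz0]

/-- The estimate that replaces the spectral theory of `C_t`. With `ψ(z) = z / (1 - t z)`, the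
bound `|f(w)| ≤ M |w| / |1 - t w|²` improves by the factor `1 / 2` under `C_t`. The path integral is
estimated along `γ(u) = ψ⁻¹(u ψ(z))`, `0 ≤ u ≤ 1`, instead of the segment: along `γ` the integrand
is bounded by `M u |ψ(z)|²`, and `γ` stays in the disc `|w| ≤ |z|`. -/
theorem norm_genCesaro_le (ht : t ∈ Set.Ico (0 : ℝ) 1) {f : ℂ → ℂ}
    (hd : DifferentiableOn ℂ f (ball 0 1)) (h0 : f 0 = 0) {M : ℝ} {z : ℂ} (hz : ‖z‖ < 1)
    (hf : ∀ w, ‖w‖ ≤ ‖z‖ → ‖f w‖ ≤ M * ‖w‖ / ‖1 - t * w‖ ^ 2) :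
    ‖genCesaro t f z‖ ≤ M / 2 * ‖z‖ / ‖1 - t * z‖ ^ 2 := by
  rcases eq_or_ne z 0 with rfl | hz0
  · simp [genCesaro_zero, h0]
  obtain ⟨F, hF0, hF⟩ := exists_primitive ht hd
  have hzn := norm_pos_iff.mpr hz0
  have hzt := one_sub_ne_zero ht hz
  -- `1 - t (1 - u) z`, the denominator of `γ u = u z / (1 - t (1 - u) z)`
  set d : ℝ → ℂ := fun u => 1 - t * (1 - u) * z with hd_def
  have hdn : ∀ u ∈ Set.Icc (0 : ℝ) 1, u ≤ ‖d u‖ ∧ d u ≠ 0 := by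
    intro u hu
    have h1 : ‖((1 - u : ℝ) : ℂ) * z‖ ≤ (1 - u) * ‖z‖ := by
      rw [norm_mul, Complex.norm_real, Real.norm_of_nonneg (by linarith [hu.2])]
    have h2 := norm_sub_norm_le (1 : ℂ) (t * (((1 - u : ℝ) : ℂ) * z))
    rw [norm_one, norm_mul, Complex.norm_real, Real.norm_of_nonneg ht.1] at h2
    have h3 : (1 : ℂ) - t * (((1 - u : ℝ) : ℂ) * z) = d u := by simp [hd_def]; ring
    rw [h3] at h2
    have h4 : t * ‖((1 - u : ℝ) : ℂ) * z‖ ≤ t * (1 - u) := by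
      refine mul_le_mul_of_nonneg_left (h1.trans ?_) ht.1
      nlinarith [hu.2]
    have h5 : u ≤ ‖d u‖ := by nlinarith [hu.2, ht.2]
    refine ⟨h5, norm_pos_iff.mp ?_⟩
    nlinarith [hu.2, ht.2, hu.1]
  set γ : ℝ → ℂ := fun u => u * z / d u with hγ_def
  have hγz : ∀ u ∈ Set.Icc (0 : ℝ) 1, ‖γ u‖ ≤ ‖z‖ := by
    intro u hu
    obtain ⟨h1, h2⟩ := hdn u hu
    rw [hγ_def, norm_div, norm_mul, Complex.norm_real, Real.norm_of_nonneg hu.1,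
      div_le_iff₀ (norm_pos_iff.mpr h2), mul_comm]
    exact mul_le_mul_of_nonneg_left h1 hzn.le
  -- `1 - t γ = (1 - t z) / (1 - t (1 - u) z)`
  have hγt : ∀ u ∈ Set.Icc (0 : ℝ) 1, 1 - t * γ u = (1 - t * z) / d u := by
    intro u hu
    have h2 := (hdn u hu).2
    simp only [hγ_def]
    field_simp
    simp only [hd_def]
    ring
  have hγ' : ∀ u ∈ Set.Icc (0 : ℝ) 1, HasDerivAt γ (z * (1 - t * z) / d u ^ 2) u := by
    intro u hu
    have e : HasDerivAt (fun u : ℝ => (u : ℂ)) 1 u := Complex.ofRealCLM.hasDerivAt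
    have h1 : HasDerivAt (fun u : ℝ => (u : ℂ) * z) z u := by simpa using e.mul_const z
    have h2 : HasDerivAt d (t * z) u := by
      simpa using (((e.const_sub 1).const_mul (t : ℂ)).mul_const z).const_sub 1
    refine (h1.div h2 (hdn u hu).2).congr_deriv ?_
    congr 1
    simp only [hd_def]
    ring
  have hder : ∀ u ∈ Set.Icc (0 : ℝ) 1, HasDerivAt (fun u => F (γ u))
      (f (γ u) / (1 - t * γ u) * (z * (1 - t * z) / d u ^ 2)) u := fun u hu =>
    (hF _ (by simpa using (hγz u hu).trans_lt hz)).comp u (hγ' u hu)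
  have hbound : ∀ u ∈ Set.Icc (0 : ℝ) 1,
      ‖f (γ u) / (1 - t * γ u) * (z * (1 - t * z) / d u ^ 2)‖ ≤
        M * (‖z‖ / ‖1 - t * z‖) ^ 2 * u := by
    intro u hu
    have h2 := norm_pos_iff.mpr (hdn u hu).2
    have h3 := norm_pos_iff.mpr hzt
    have h1 := hf (γ u) (hγz u hu)
    rw [hγt u hu] at h1 ⊢
    have h4 : ‖γ u‖ = u * ‖z‖ / ‖d u‖ := by
      rw [hγ_def, norm_div, norm_mul, Complex.norm_real, Real.norm_of_nonneg hu.1]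
    rw [h4] at h1
    simp only [norm_mul, norm_div, norm_pow] at h1 ⊢
    calc _ ≤ M * (u * ‖z‖ / ‖d u‖) / (‖1 - t * z‖ / ‖d u‖) ^ 2 / (‖1 - t * z‖ / ‖d u‖) *
          (‖z‖ * ‖1 - t * z‖ / ‖d u‖ ^ 2) := by gcongr
      _ = _ := by field_simp
  have hB : ∀ u : ℝ, HasDerivAt (fun u => M * (‖z‖ / ‖1 - t * z‖) ^ 2 * (u ^ 2 / 2))
      (M * (‖z‖ / ‖1 - t * z‖) ^ 2 * u) u := fun u =>
    (((hasDerivAt_pow 2 u).div_const 2).const_mul _).congr_deriv (by simp)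
  have hfin := image_norm_le_of_norm_deriv_right_le_deriv_boundary (a := 0) (b := 1)
    (fun u hu => (hder u hu).continuousAt.continuousWithinAt)
    (fun u hu => (hder u (Set.Ico_subset_Icc_self hu)).hasDerivWithinAt)
    (by simp [hγ_def, hF0]) hB (fun u hu => hbound u (Set.Ico_subset_Icc_self hu))
    (Set.right_mem_Icc.mpr zero_le_one)
  have hγ1 : γ 1 = z := by simp [hγ_def, hd_def]
  simp only [hγ1] at hfin
  rw [← mul_genCesaro_eq ht hd.continuousOn hF0 hF (by simpa using hz), norm_mul] at hfin
  refine le_of_mul_le_mul_left (hfin.trans_eq ?_) hzn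
  ring

/-- The function `1 / (1 - t z)` is fixed by `C_t`. -/
theorem genCesaro_eigenfunction (ht : t ∈ Set.Ico (0 : ℝ) 1) {h : ℂ → ℂ}
    (hh : ∀ z ∈ ball (0 : ℂ) 1, h z = (1 - t * z)⁻¹) {z : ℂ} (hz : z ∈ ball (0 : ℂ) 1) :
    genCesaro t h z = h z := by
  rcases eq_or_ne z 0 with rfl | hz0
  · exact genCesaro_zero h
  have hne : ∀ w ∈ ball (0 : ℂ) 1, 1 - t * w ≠ 0 := fun w hw =>
    one_sub_ne_zero ht (mem_ball_zero_iff.mp hw)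
  have hc : ContinuousOn h (ball 0 1) :=
    ContinuousOn.congr (f := fun z : ℂ => (1 - t * z)⁻¹) (ContinuousOn.inv₀ (by fun_prop) hne) hh
  refine mul_left_cancel₀ hz0 ((mul_genCesaro_eq ht hc (F := fun z => z / (1 - t * z)) (by simp)
    (fun w hw => ?_) hz).trans (by rw [hh z hz, div_eq_mul_inv]))
  have h1 : HasDerivAt (fun w : ℂ => 1 - t * w) (-t) w := by
    simpa using ((hasDerivAt_id w).const_mul (t : ℂ)).const_sub 1
  refine ((hasDerivAt_id w).div h1 (hne w hw)).congr_deriv ?_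
  have := hne w hw
  rw [hh w hw]
  simp only [id]
  field_simp
  ring

theorem genCesaro_add (ht : t ∈ Set.Ico (0 : ℝ) 1) {f g : ℂ → ℂ}
    (hf : DifferentiableOn ℂ f (ball 0 1)) (hg : DifferentiableOn ℂ g (ball 0 1)) {z : ℂ}
    (hz : z ∈ ball (0 : ℂ) 1) : genCesaro t (f + g) z = genCesaro t f z + genCesaro t g z := by
  rcases eq_or_ne z 0 with rfl | hz0
  · simp [genCesaro_zero]
  obtain ⟨F, hF0, hF⟩ := exists_primitive ht hf
  obtain ⟨G, hG0, hG⟩ := exists_primitive ht hg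
  refine mul_left_cancel₀ hz0 ?_
  rw [mul_add, mul_genCesaro_eq ht hf.continuousOn hF0 hF hz,
    mul_genCesaro_eq ht hg.continuousOn hG0 hG hz,
    mul_genCesaro_eq ht (hf.add hg).continuousOn (F := F + G) (by simp [hF0, hG0])
      (fun w hw => ((hF w hw).add (hG w hw)).congr_deriv (by simp [add_div])) hz, Pi.add_apply]

theorem genCesaro_smul (c : ℂ) (f : ℂ → ℂ) (z : ℂ) :
    genCesaro t (c • f) z = c * genCesaro t f z := by
  unfold genCesaro
  split_ifs
  · rfl
  · rw [mul_left_comm, ← intervalIntegral.integral_const_mul c]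
    refine congrArg (fun I : ℝ → ℂ => z⁻¹ * ∫ s in (0 : ℝ)..1, I s) ?_
    funext s
    rw [Pi.smul_apply, smul_eq_mul]
    ring

theorem genCesaro_growth (ht : t ∈ Set.Ico (0 : ℝ) 1) {f : ℂ → ℂ} {k : ℕ} {A : ℝ}
    (hf : ∀ z ∈ ball (0 : ℂ) 1, logWeight ‖z‖ ^ k * ‖f z‖ ≤ A) {z : ℂ}
    (hz : z ∈ ball (0 : ℂ) 1) : logWeight ‖z‖ ^ k * ‖genCesaro t f z‖ ≤ (1 - t)⁻¹ * A := by
  have ht1 : 0 < 1 - t := sub_pos.mpr ht.2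
  rw [mem_ball_zero_iff] at hz
  have hw := pow_pos (logWeight_pos hz) k
  have hA : 0 ≤ A := (mul_nonneg (pow_nonneg (logWeight_pos (by simp)).le _)
    (norm_nonneg _)).trans (hf 0 (by simp))
  have hw1 := pow_le_one₀ (logWeight_pos hz).le (logWeight_le_one hz) (n := k)
  have hle : ∀ w : ℂ, ‖w‖ ≤ ‖z‖ → ‖f w‖ ≤ A / logWeight ‖z‖ ^ k := by
    intro w hwz
    rw [le_div_iff₀' hw]
    exact (mul_le_mul_of_nonneg_right (pow_le_pow_left₀ (logWeight_pos hz).le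
      (logWeight_antitoneOn (hwz.trans_lt hz) hz hwz) k) (norm_nonneg _)).trans
        (hf w (by simpa using hwz.trans_lt hz))
  suffices h : ‖genCesaro t f z‖ ≤ (1 - t)⁻¹ * (A / logWeight ‖z‖ ^ k) by
    refine (mul_le_mul_of_nonneg_left h hw.le).trans_eq ?_
    field_simp
  rcases eq_or_ne z 0 with rfl | hz0
  · rw [genCesaro_zero]
    have h1 : 1 ≤ (1 - t)⁻¹ := (one_le_inv₀ ht1).mpr (by linarith [ht.1])
    have h2 : 0 ≤ A / logWeight ‖(0 : ℂ)‖ ^ k := by positivity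
    nlinarith [hle 0 le_rfl]
  · rw [genCesaro, if_neg hz0, norm_mul, norm_inv,
      inv_mul_le_iff₀ (norm_pos_iff.mpr hz0)]
    have := intervalIntegral.norm_integral_le_of_norm_le_const (a := 0) (b := 1)
      (f := fun s : ℝ => f (s * z) / (1 - t * (s * z)) * z)
      (C := ‖z‖ * ((1 - t)⁻¹ * (A / logWeight ‖z‖ ^ k))) fun s hs => ?_
    · simpa using this
    · rw [Set.uIoc_of_le zero_le_one] at hs
      have hsz : ‖(s : ℂ) * z‖ ≤ ‖z‖ := by
        rw [norm_mul, Complex.norm_real, Real.norm_of_nonneg hs.1.le]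
        nlinarith [hs.2, norm_nonneg z]
      rw [norm_mul, norm_div, mul_comm ‖z‖, mul_comm (1 - t)⁻¹, ← div_eq_mul_inv]
      have h1 := one_sub_le_norm_one_sub ht (hsz.trans_lt hz)
      have h2 := hle _ hsz
      gcongr

end Cesaro

/-! ### Elements of `VH(𝔻)` and their bounds -/

namespace VH

theorem differentiableOn (f : VH) : DifferentiableOn ℂ f (ball 0 1) := by
  obtain ⟨_, h⟩ := f.2
  exact h.1.1

theorem ext {f g : VH} (h : ∀ z ∈ ball (0 : ℂ) 1, f z = g z) : f = g := by
  obtain ⟨_, hf⟩ := f.2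
  obtain ⟨_, hg⟩ := g.2
  refine Subtype.ext (funext fun z => ?_)
  by_cases hz : z ∈ ball (0 : ℂ) 1
  · exact h z hz
  · rw [hf.1.2 z hz, hg.1.2 z hz]

@[simp] theorem add_apply (f g : VH) (z : ℂ) : (f + g) z = f z + g z := rfl

@[simp] theorem sub_apply (f g : VH) (z : ℂ) : (f - g) z = f z - g z := rfl

@[simp] theorem smul_apply (c : ℂ) (f : VH) (z : ℂ) : (c • f) z = c * f z := rfl

@[simp] theorem zero_apply (z : ℂ) : (0 : VH) z = 0 := rfl

namespace GrowthBound

variable {k : ℕ} {A B : ℝ} {f g : VH}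

theorem nonneg (hf : GrowthBound k A f) : 0 ≤ A :=
  (mul_nonneg (pow_nonneg (logWeight_pos (by simp)).le _) (norm_nonneg _)).trans (hf 0 (by simp))

theorem mono (hf : GrowthBound k A f) (h : A ≤ B) : GrowthBound k B f :=
  fun z hz => (hf z hz).trans h

theorem add (hf : GrowthBound k A f) (hg : GrowthBound k B g) : GrowthBound k (A + B) (f + g) := by
  intro z hz
  have h := mul_le_mul_of_nonneg_left (norm_add_le (f z) (g z))
    (pow_nonneg (logWeight_pos (mem_ball_zero_iff.mp hz)).le k)
  rw [add_apply]
  linarith [hf z hz, hg z hz]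

theorem smul (c : ℂ) (hf : GrowthBound k A f) : GrowthBound k (‖c‖ * A) (c • f) := by
  intro z hz
  rw [smul_apply, norm_mul, mul_left_comm]
  exact mul_le_mul_of_nonneg_left (hf z hz) (norm_nonneg c)

theorem sum {ι : Type*} (s : Finset ι) {A : ι → ℝ} {f : ι → VH}
    (h : ∀ i ∈ s, GrowthBound k (A i) (f i)) : GrowthBound k (∑ i ∈ s, A i) (∑ i ∈ s, f i) := by
  classical
  induction s using Finset.induction_on with
  | empty => exact fun z _ => by simp
  | insert i s hi ih =>
    rw [Finset.sum_insert hi, Finset.sum_insert hi]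
    exact (h i (by simp)).add (ih fun j hj => h j (by simp [hj]))

theorem norm_apply_zero_le (hf : GrowthBound k A f) : ‖f 0‖ ≤ A := by
  simpa [logWeight_of_le_half] using hf 0 (by simp)

end GrowthBound

theorem exists_growthBound (f : VH) : ∃ n A, GrowthBound (n + 1) A f := by
  obtain ⟨n, hn⟩ := f.2
  exact ⟨n, ‖(show LogGrowth (n + 1) from ⟨f.1, hn⟩)‖, growthBound_incl n _⟩

/-- The element of `VH(𝔻)` defined by a function on the plane, through its values on the disc. -/
noncomputable def restrict (g : ℂ → ℂ) (hg : DifferentiableOn ℂ g (ball 0 1))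
    (hb : ∃ n A, ∀ z ∈ ball (0 : ℂ) 1, logWeight ‖z‖ ^ (n + 1) * ‖g z‖ ≤ A) : VH :=
  ⟨(ball (0 : ℂ) 1).indicator g, hb.choose,
    ⟨hg.congr fun _ hz => Set.indicator_of_mem hz g, fun _ hz => Set.indicator_of_notMem hz g⟩, by
      obtain ⟨A, hA⟩ := hb.choose_spec
      refine ⟨A, ?_⟩
      rintro _ ⟨z, rfl⟩
      simpa only [Set.indicator_of_mem z.2] using hA z z.2⟩

theorem restrict_apply {g : ℂ → ℂ} (hg : DifferentiableOn ℂ g (ball 0 1))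
    (hb : ∃ n A, ∀ z ∈ ball (0 : ℂ) 1, logWeight ‖z‖ ^ (n + 1) * ‖g z‖ ≤ A) {z : ℂ}
    (hz : z ∈ ball (0 : ℂ) 1) : restrict g hg hb z = g z :=
  Set.indicator_of_mem hz g

theorem exists_growth_of_norm_le {g : ℂ → ℂ} {B : ℝ} (hg : ∀ z ∈ ball (0 : ℂ) 1, ‖g z‖ ≤ B) :
    ∃ n A, ∀ z ∈ ball (0 : ℂ) 1, logWeight ‖z‖ ^ (n + 1) * ‖g z‖ ≤ A := by
  refine ⟨0, B, fun z hz => (mul_le_of_le_one_left (norm_nonneg _) ?_).trans (hg z hz)⟩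
  rw [mem_ball_zero_iff] at hz
  exact pow_le_one₀ (logWeight_pos hz).le (logWeight_le_one hz)

/-- The coordinate function `z`. -/
noncomputable def coord : VH :=
  restrict id differentiableOn_id (exists_growth_of_norm_le (B := 1) fun _ hz =>
    (mem_ball_zero_iff.mp hz).le)

/-! ### The operator on `VH(𝔻)` -/

variable {t : ℝ} (ht : t ∈ Set.Ico (0 : ℝ) 1)

/-- The function `1 / (1 - t z)`, which spans the fixed points of `C_t`. -/
noncomputable def geom : VH :=
  restrict (fun z => (1 - t * z)⁻¹)
    (DifferentiableOn.inv (by fun_prop) fun _ hz => one_sub_ne_zero ht (mem_ball_zero_iff.mp hz))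
    (exists_growth_of_norm_le (B := (1 - t)⁻¹) fun _ hz => by
      rw [norm_inv]
      exact inv_anti₀ (sub_pos.mpr ht.2) (one_sub_le_norm_one_sub ht (mem_ball_zero_iff.mp hz)))

theorem geom_apply {z : ℂ} (hz : z ∈ ball (0 : ℂ) 1) : geom ht z = (1 - t * z)⁻¹ :=
  restrict_apply _ _ hz

theorem geom_zero : geom ht 0 = 1 := by
  simp [geom_apply ht (mem_ball_self one_pos)]

theorem growthBound_geom (k : ℕ) : GrowthBound k (1 - t)⁻¹ (geom ht) := by
  intro z hz
  have hz' := mem_ball_zero_iff.mp hz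
  rw [geom_apply ht hz, norm_inv]
  exact (mul_le_of_le_one_left (by positivity)
    (pow_le_one₀ (logWeight_pos hz').le (logWeight_le_one hz'))).trans
    (inv_anti₀ (sub_pos.mpr ht.2) (one_sub_le_norm_one_sub ht hz'))

theorem exists_growth_genCesaro {t : ℝ} (ht : t ∈ Set.Ico (0 : ℝ) 1) (f : VH) :
    ∃ n A, ∀ z ∈ ball (0 : ℂ) 1, logWeight ‖z‖ ^ (n + 1) * ‖genCesaro t f z‖ ≤ A := by
  obtain ⟨n, A, hA⟩ := exists_growthBound f
  exact ⟨n, _, fun z hz => genCesaro_growth ht hA hz⟩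

/-- The operator `C_t` on `VH(𝔻)`, as a linear map. -/
noncomputable def cesaroₗ : VH →ₗ[ℂ] VH where
  toFun f := restrict (genCesaro t f) (differentiableOn_genCesaro ht f.differentiableOn)
    (exists_growth_genCesaro ht f)
  map_add' f g := ext fun z hz => by
    rw [add_apply, restrict_apply _ _ hz, restrict_apply _ _ hz, restrict_apply _ _ hz]
    exact genCesaro_add ht f.differentiableOn g.differentiableOn hz
  map_smul' c f := ext fun z hz => by
    rw [RingHom.id_apply, smul_apply, restrict_apply _ _ hz, restrict_apply _ _ hz]
    exact genCesaro_smul c f z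

theorem cesaroₗ_apply (f : VH) {z : ℂ} (hz : z ∈ ball (0 : ℂ) 1) :
    cesaroₗ ht f z = genCesaro t f z :=
  restrict_apply (differentiableOn_genCesaro ht f.differentiableOn)
    (exists_growth_genCesaro ht f) hz

/-- The operator `C_t` on `VH(𝔻)`. -/
noncomputable def cesaro : VH →L[ℂ] VH where
  toLinearMap := cesaroₗ ht
  cont := continuous_of_growthBound (cesaroₗ ht) fun _ =>
    ⟨(1 - t)⁻¹, inv_nonneg.mpr (sub_pos.mpr ht.2).le, fun _ f hf _ hz =>
      cesaroₗ_apply ht f hz ▸ genCesaro_growth ht hf hz⟩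

theorem cesaro_apply (f : VH) {z : ℂ} (hz : z ∈ ball (0 : ℂ) 1) :
    cesaro ht f z = genCesaro t f z :=
  cesaroₗ_apply ht f hz

theorem cesaro_pow_apply_zero (n : ℕ) (f : VH) : (cesaro ht ^ n) f 0 = f 0 := by
  induction n with
  | zero => rfl
  | succ n ih =>
    rw [pow_succ', mul_apply_eq_comp, cesaro_apply ht _ (mem_ball_self one_pos),
      genCesaro_zero, ih]

theorem cesaro_geom : cesaro ht (geom ht) = geom ht :=
  ext fun _ hz => (cesaro_apply ht _ hz).trans
    (genCesaro_eigenfunction ht (fun _ => geom_apply ht) hz)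

theorem cesaro_pow_geom (n : ℕ) : (cesaro ht ^ n) (geom ht) = geom ht := by
  induction n with
  | zero => rfl
  | succ n ih => rw [pow_succ, mul_apply_eq_comp, cesaro_geom, ih]

theorem norm_cesaro_pow_le {f : VH} (h0 : f 0 = 0) {M r : ℝ} (hr : r < 1)
    (hf : ∀ w : ℂ, ‖w‖ ≤ r → ‖f w‖ ≤ M * ‖w‖ / ‖1 - t * w‖ ^ 2) (n : ℕ) {w : ℂ} (hw : ‖w‖ ≤ r) :
    ‖(cesaro ht ^ n) f w‖ ≤ M / 2 ^ n * ‖w‖ / ‖1 - t * w‖ ^ 2 := by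
  induction n generalizing w with
  | zero => simpa using hf w hw
  | succ n ih =>
    have hw1 := hw.trans_lt hr
    rw [pow_succ', mul_apply_eq_comp, cesaro_apply ht _ (by simpa using hw1), pow_succ,
      ← div_div]
    exact norm_genCesaro_le ht (differentiableOn _) (by rw [cesaro_pow_apply_zero, h0]) hw1
      fun v hv => ih (hv.trans hw)

/-- On functions vanishing at `0`, the iterates of `C_t` decay geometrically on each step. -/
theorem GrowthBound.cesaro_pow_of_apply_zero {k : ℕ} {A : ℝ} {f : VH} (hf : GrowthBound k A f)
    (h0 : f 0 = 0) (n : ℕ) :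
    GrowthBound k (8 / (1 - t) ^ 2 * A / 2 ^ n) ((cesaro ht ^ n) f) := by
  intro z hz
  have hz1 := mem_ball_zero_iff.mp hz
  have ht1 : 0 < 1 - t := sub_pos.mpr ht.2
  have hv := pow_pos (logWeight_pos hz1) k
  have hA := hf.nonneg
  have h := norm_cesaro_pow_le ht h0 (M := 8 * A / logWeight ‖z‖ ^ k) hz1 (fun w hw => ?_) n le_rfl
  · have h1 := one_sub_le_norm_one_sub ht hz1
    calc _ ≤ logWeight ‖z‖ ^ k * (8 * A / logWeight ‖z‖ ^ k / 2 ^ n * 1 / (1 - t) ^ 2) := by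
          refine mul_le_mul_of_nonneg_left (h.trans ?_) hv.le
          gcongr
      _ = _ := by field_simp
  · have hw1 := hw.trans_lt hz1
    refine (norm_le_of_growth f.differentiableOn hf h0 hz1 hw).trans ?_
    have h2 : ‖1 - (t : ℂ) * w‖ ≤ 2 := by
      refine (norm_sub_le _ _).trans ?_
      rw [norm_one, norm_mul, Complex.norm_real, Real.norm_of_nonneg ht.1]
      nlinarith [ht.1, ht.2, norm_nonneg w]
    have h3 := norm_pos_iff.mpr (one_sub_ne_zero ht hw1)
    have h4 : ‖1 - (t : ℂ) * w‖ ^ 2 ≤ 4 := by nlinarith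
    rw [le_div_iff₀ (by positivity)]
    have h5 : 0 ≤ 2 * A / logWeight ‖z‖ ^ k * ‖w‖ := by positivity
    refine (mul_le_mul_of_nonneg_left h4 h5).trans_eq ?_
    ring

/-- The limit of the iterates of `C_t`, the projection `f ↦ f(0) / (1 - t z)`. -/
noncomputable def limitProj : VH →L[ℂ] VH where
  toFun f := f 0 • geom ht
  map_add' _ _ := add_smul _ _ _
  map_smul' _ _ := mul_smul _ _ _
  cont := (continuous_eval (mem_ball_self one_pos)).smul continuous_const

theorem limitProj_apply (f : VH) : limitProj ht f = f 0 • geom ht := rfl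

theorem growthBound_limitProj {k : ℕ} {A : ℝ} {f : VH} (hf : GrowthBound k A f) :
    GrowthBound k ((1 - t)⁻¹ * A) (limitProj ht f) := by
  refine ((growthBound_geom ht k).smul (f 0)).mono ?_
  rw [mul_comm]
  exact mul_le_mul_of_nonneg_left hf.norm_apply_zero_le (inv_nonneg.mpr (sub_pos.mpr ht.2).le)

/-- On each step the iterates `C_t ^ n` converge to the projection geometrically in operator
norm. -/
theorem exists_growthBound_cesaro_pow_sub :
    ∃ K, 0 ≤ K ∧ ∀ k A f, GrowthBound k A f → ∀ n,
      GrowthBound k (K * A * (1 / 2) ^ n) ((cesaro ht ^ n) f - limitProj ht f) := by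
  have ht1 : 0 < 1 - t := sub_pos.mpr ht.2
  refine ⟨8 / (1 - t) ^ 2 * (1 + (1 - t)⁻¹), by positivity, fun k A f hf n => ?_⟩
  have h1 := hf.add ((growthBound_limitProj ht hf).smul (-1))
  have h2 : f + (-1 : ℂ) • limitProj ht f = f - limitProj ht f := by
    rw [neg_one_smul, sub_eq_add_neg]
  rw [h2] at h1
  have h3 := h1.cesaro_pow_of_apply_zero ht (by simp [limitProj_apply, geom_zero]) n
  rw [map_sub, limitProj_apply, map_smul, cesaro_pow_geom, ← limitProj_apply] at h3
  refine h3.mono (le_of_eq ?_)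
  simp only [norm_neg, norm_one]
  rw [one_div, inv_pow]
  ring

/-! ### Dynamics of the operator -/

theorem isPowerBounded_cesaro : IsPowerBounded (cesaro ht) := by
  obtain ⟨K, hK0, hK⟩ := exists_growthBound_cesaro_pow_sub ht
  have ht1 : 0 < 1 - t := sub_pos.mpr ht.2
  refine equicontinuous_of_growthBound (fun n => (cesaro ht ^ n).toLinearMap) fun k =>
    ⟨K + (1 - t)⁻¹, by positivity, fun n A f hf => ?_⟩
  have h := (hK _ A f hf n).add (growthBound_limitProj ht hf)
  rw [sub_add_cancel] at h
  refine h.mono ?_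
  have h1 : ((1 : ℝ) / 2) ^ n ≤ 1 := pow_le_one₀ (by norm_num) (by norm_num)
  nlinarith [mul_nonneg hK0 hf.nonneg]

theorem nsmul_ergodicMean_sub (T P : VH →L[ℂ] VH) (n : ℕ) (f : VH) :
    n • (ergodicMean T n - P) f = ∑ m ∈ Finset.Icc 1 n, ((T ^ m) f - P f) := by
  rcases eq_or_ne n 0 with rfl | hn
  · simp
  · have hn' : (n : ℂ) ≠ 0 := Nat.cast_ne_zero.mpr hn
    rw [Finset.sum_sub_distrib, Finset.sum_const, Nat.card_Icc, Nat.add_sub_cancel,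
      _root_.sub_apply, smul_sub, ergodicMean, _root_.smul_apply,
      ← Nat.cast_smul_eq_nsmul ℂ n ((n : ℂ)⁻¹ • _), smul_inv_smul₀ hn',
      sum_apply]

theorem sum_Icc_half_pow_le (n : ℕ) : ∑ m ∈ Finset.Icc 1 n, ((1 : ℝ) / 2) ^ m ≤ 1 := by
  suffices h : ∑ m ∈ Finset.Icc 1 n, ((1 : ℝ) / 2) ^ m = 1 - (1 / 2) ^ n by
    rw [h]
    exact sub_le_self _ (by positivity)
  induction n with
  | zero => simp
  | succ n ih =>
    rw [Finset.sum_Icc_succ_top (by omega), ih]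
    ring

theorem isUniformlyMeanErgodic_cesaro : IsUniformlyMeanErgodic (cesaro ht) := by
  obtain ⟨K, hK0, hK⟩ := exists_growthBound_cesaro_pow_sub ht
  refine ⟨limitProj ht, tendsto_sub_nhds_zero_iff.mp ?_⟩
  refine tendsto_zero_of_seminorm_bound _ fun p hp => ?_
  have hT : ∀ k, ∃ M, 0 ≤ M ∧ ∀ n A f, GrowthBound (k + 1) A f → GrowthBound (k + 1) (M * A)
      ((n • (ergodicMean (cesaro ht) n - limitProj ht)).toLinearMap f) := by
    refine fun k => ⟨K, hK0, fun n A f hf => ?_⟩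
    have h := GrowthBound.sum (Finset.Icc 1 n) fun m _ => hK _ A f hf m
    rw [← nsmul_ergodicMean_sub, ← Finset.mul_sum] at h
    exact h.mono (mul_le_of_le_one_right (mul_nonneg hK0 hf.nonneg) (sum_Icc_half_pow_le n))
  obtain ⟨q, hq, hpq⟩ := exists_seminorm_dominating _ hT p hp
  exact ⟨q, hq, fun n => hpq n⟩

/-- If `f(0) = 0`, the projective orbit lies in the closed hyperplane `g(0) = 0`. Otherwise the
distances of `C_t ^ n f (1/2)` from their limit are bounded by a multiple of `|f(0)|`, and the
resulting inequality is homogeneous and closed, and it fails for the function `z`. -/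
theorem not_isSupercyclic_cesaro : ¬ IsSupercyclic (cesaro ht) := by
  rintro ⟨f, hf⟩
  have hz0 : (0 : ℂ) ∈ ball (0 : ℂ) 1 := mem_ball_self one_pos
  have hz : (1 / 2 : ℂ) ∈ ball (0 : ℂ) 1 := by
    rw [mem_ball_zero_iff]
    norm_num
  have hall : ∀ S : Set VH, IsClosed S → (∀ (c : ℂ) (n : ℕ), c • (cesaro ht ^ n) f ∈ S) → ∀ g, g ∈ S := by
    intro S hS hmem g
    refine closure_minimal ?_ hS (hf g)
    rintro _ ⟨c, n, rfl⟩
    exact hmem c n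
  by_cases h0 : f 0 = 0
  · have := hall {g | g 0 = 0} (isClosed_eq (continuous_eval hz0) continuous_const)
      (fun c n => by
        rw [Set.mem_ofPred_eq, smul_apply, cesaro_pow_apply_zero, h0, mul_zero]) (geom ht)
    simp [geom_zero] at this
  · obtain ⟨K, hK0, hK⟩ := exists_growthBound_cesaro_pow_sub ht
    obtain ⟨k, A, hA⟩ := exists_growthBound f
    have hn0 := norm_pos_iff.mpr h0
    have hKA := mul_nonneg hK0 hA.nonneg
    have hb : ∀ n, ‖(cesaro ht ^ n) f (1 / 2) - f 0 * geom ht (1 / 2)‖ ≤ K * A := by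
      intro n
      have h := hK _ A f hA n (1 / 2) hz
      rw [logWeight_of_le_half (by norm_num), one_pow, one_mul] at h
      exact h.trans (mul_le_of_le_one_right hKA (pow_le_one₀ (by norm_num) (by norm_num)))
    have := hall {g | ‖g (1 / 2) - g 0 * geom ht (1 / 2)‖ ≤ K * A / ‖f 0‖ * ‖g 0‖}
      (isClosed_le ((continuous_eval hz).sub
        ((continuous_eval hz0).mul continuous_const)).norm
        (continuous_const.mul (continuous_eval hz0).norm)) (fun c n => ?_) coord
    · rw [Set.mem_ofPred_eq, coord, restrict_apply _ _ hz0, restrict_apply _ _ hz] at this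
      norm_num at this
    · rw [Set.mem_ofPred_eq, smul_apply, smul_apply, cesaro_pow_apply_zero, mul_assoc, ← mul_sub,
        norm_mul, norm_mul]
      calc _ ≤ ‖c‖ * (K * A) := mul_le_mul_of_nonneg_left (hb n) (norm_nonneg c)
        _ = _ := by field_simp

end VH

theorem proposition3p7 (t : ℝ) (ht : t ∈ Set.Ico (0 : ℝ) 1) :
    ∃ C : VH →L[ℂ] VH, (∀ f : VH, ∀ z ∈ ball (0 : ℂ) 1, C f z = genCesaro t f z) ∧
      IsPowerBounded C ∧ IsUniformlyMeanErgodic C ∧ ¬ IsSupercyclic C :=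
  ⟨VH.cesaro ht, fun f _ hz => VH.cesaro_apply ht f hz, VH.isPowerBounded_cesaro ht,
    VH.isUniformlyMeanErgodic_cesaro ht, VH.not_isSupercyclic_cesaro ht⟩
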